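/- Let $n\ge 1$ and let $\mathbf B=\{z\in\mathbb C^n:\|z\|_X<1\}$ be the open unit ball of a norm $\|\cdot\|_X$ on $\mathbb C^n$, and assume that $\mathbf B$ is homogeneous, i.e. its group of biholomorphic automorphisms acts transitively on it. Let $\|\cdot\|_e$ be the Euclidean norm on $\mathbb C^n$ and $\|A\|=\sup_{\xi\ne0}\|A\xi\|_e/\|\xi\|_e$ for complex linear maps $A$ of $\mathbb C^n$. For $k\in[0,1)$ let $\mathscr{PH}(k)$ be the class of all maps $f=h+\overline g:\mathbf B\to\mathbb C^n$ (coordinatewise conjugation), where $h,g:\mathbf B\to\mathbb C^n$ are holomorphic, $h$ is locally biholomorphic, $h(0)=g(0)=0$, and $\omega_f(z):=Dg(z)[Dh(z)]^{-1}$ satisfies $\|\omega_f(z)\|\le k$ for all $z\in\mathbf B$. For a map $F:\mathbf B\to\mathbb C^n$ and $a\in\mathbf B$ let $\mathscr B_F(a)$ be the largest $r>0$ such that some open set $V\subseteq\mathbf B$ with $a\in V$ is mapped by $F$ bijectively onto the Euclidean ball of radius $r$ centered at $F(a)$. Put $$\mu_k(x)=1+k\left[\frac1x+\Big(1-\frac1{x^2}\Big)\log(1+x)\right]\quad(0<x\le1),\qquad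 \mu_k(0)=\lim_{x\to0^+}\mu_k(x)=1+\frac k2 .$$ Let $k\in[0,1)$ and $f=h+\overline g\in\mathscr{PH}(k)$. Then for every $z\in\mathbf B$ the largest radii $\mathscr B_f(z)$ and $\mathscr B_h(z)$ exist in $(0,\infty)$, and $$1-k\ \le\ \frac{\mathscr B_f(z)}{\mathscr B_h(z)}\ \le\ \mu_k\!\left(\frac{\|\omega_f(z)\|}{k}\right)\ \le\ \mu_k(1)=1+k ,$$ where for $k=0$ the quotient $\|\omega_f(z)\|/k$ is read as $0$ (note that $\mu_0\equiv1$). The lower bound is sharp at every point: for every $k\in[0,1)$ and every $z\in\mathbf B$ there is $f=h+\overline g\in\mathscr{PH}(k)$ with $\mathscr B_f(z)/\mathscr B_h(z)=1-k$. The upper bound is asymptotically sharp as $k\to0^+$: one has $\lim_{k\to0^+}\mu_k(x)=1$ for each $x\in[0,1]$, and for every $\varepsilon>0$ there is $\delta\in(0,1]$ such that for all $k\in(0,\delta)$, all $f=h+\overline g\in\mathscr{PH}(k)$ and all $z\in\mathbf B$, $$\frac{\mathscr B_f(z)}{\mathscr B_h(z)}>(1-\varepsilon)\,\mu_k\!\left(\frac{\|\omega_f(z)\|}{k}\right)\quad\text{and}\quad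 \frac{\mathscr B_f(z)}{\mathscr B_h(z)}>(1-\varepsilon)(1+k);$$ moreover, for all $k\in(0,1)$, $z\in\mathbf B$ and $x\in[0,1]$ there is $f\in\mathscr{PH}(k)$ with $\|\omega_f(z)\|/k=x$. -/

import Mathlib

open Set Filter Topology

namespace PluriBloch

/-- Complex Euclidean space of dimension `n`; its norm is the Euclidean norm. -/
abbrev Cn (n : ℕ) : Type := EuclideanSpace ℂ (Fin n)

/-- `φ` maps the open set `U` biholomorphically onto the open set `V`. -/
structure IsBiholomorphism {n : ℕ} (φ : Cn n → Cn n) (U V : Set (Cn n)) : Prop where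
  isOpen_source : IsOpen U
  isOpen_target : IsOpen V
  holomorphic : DifferentiableOn ℂ φ U
  bijOn : BijOn φ U V
  holomorphic_inverse : ∃ ψ : Cn n → Cn n, DifferentiableOn ℂ ψ V ∧ LeftInvOn ψ φ U

/-- `B` is homogeneous: its biholomorphic automorphisms act transitively. -/
def IsHomogeneous {n : ℕ} (B : Set (Cn n)) : Prop :=
  ∀ x ∈ B, ∀ y ∈ B, ∃ φ : Cn n → Cn n, IsBiholomorphism φ B B ∧ φ x = y

/-- `h` is locally biholomorphic in `B`. -/
def IsLocallyBiholomorphic {n : ℕ} (h : Cn n → Cn n) (B : Set (Cn n)) : Prop :=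
  ∀ z ∈ B, ∃ U V : Set (Cn n), z ∈ U ∧ U ⊆ B ∧ IsBiholomorphism h U V

/-- Coordinatewise complex conjugation. -/
def conjVec {n : ℕ} (v : Cn n) : Cn n :=
  WithLp.toLp 2 fun i => (starRingEnd ℂ) (v i)

/-- The map `f = h + conj g`. -/
def pluri {n : ℕ} (h g : Cn n → Cn n) : Cn n → Cn n :=
  fun z => h z + conjVec (g z)

/-- The dilatation `ω_f(z) = Dg(z) [Dh(z)]⁻¹`; its norm is the operator norm for the
Euclidean norm. -/
noncomputable def dilatation {n : ℕ} (h g : Cn n → Cn n) (z : Cn n) : Cn n →L[ℂ] Cn n :=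
  (fderiv ℂ g z).comp (fderiv ℂ h z).inverse

/-- The pair `(h, g)` represents a member `f = h + conj g` of the class `PH(k)` on `B`. -/
structure IsPH {n : ℕ} (B : Set (Cn n)) (k : ℝ) (h g : Cn n → Cn n) : Prop where
  locally_biholomorphic : IsLocallyBiholomorphic h B
  holomorphic : DifferentiableOn ℂ g B
  h_zero : h 0 = 0
  g_zero : g 0 = 0
  dilatation_le : ∀ z ∈ B, ‖dilatation h g z‖ ≤ k

/-- The radii of the univalent Euclidean balls in `f(B)` centered at `f(a)`: some open subset of
`B` containing `a` is mapped by `f` one-to-one onto the ball. -/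
def univalentRadii {n : ℕ} (B : Set (Cn n)) (f : Cn n → Cn n) (a : Cn n) : Set ℝ :=
  {r | 0 < r ∧ ∃ V : Set (Cn n), IsOpen V ∧ V ⊆ B ∧ a ∈ V ∧ BijOn f V (Metric.ball (f a) r)}

/-- The radius of the largest univalent ball in `f(B)` centered at `f(a)`. -/
noncomputable def blochRadius {n : ℕ} (B : Set (Cn n)) (f : Cn n → Cn n) (a : Cn n) : ℝ :=
  sSup (univalentRadii B f a)

/-- The function `μ_k(x)` for `0 ≤ x ≤ 1`. -/
noncomputable def mu (k x : ℝ) : ℝ :=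
  if x = 0 then 1 + k / 2
  else 1 + k * (1 / x + (1 - 1 / x ^ 2) * Real.log (1 + x))

end PluriBloch

/-! Let R be the Bloch radius of h at z and Φ the local inverse of h on the ball of radius R about
h(z) with Φ(h(z)) = z. Then f ∘ Φ = id + conj ψ with ψ = g ∘ Φ, and the chain rule gives Dψ(w) =
ω_f(Φ(w)). In the coordinate w = h, f is therefore the identity plus a k-Lipschitz perturbation.

Lower bound: such a map univalently covers a ball of radius (1 - k)R (`exists_rightInv_addConj`).

Upper bound: Schwarz-Pick controls the derivative of ψ along rays from the centre, starting from
‖ω_f(z)‖; integration keeps f ∘ Φ within μ_k R of f(z) (`norm_sub_le_growth`). If f had an inverse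
branch G on a ball of radius ρ > μ_k R, then G ∘ (id + conj ψ), extended to the closed ball of
radius R, would invert h there with values in B. By compactness h would then have an inverse branch
on a larger ball, contradicting the choice of R (`IsPH.univalentRadii_le`).

The lower bound is attained by h = id and a rank-one linear g. Asymptotic sharpness needs no further
examples: both bounds tend to 1 with k. -/

namespace PluriBloch

/-! ### Local homeomorphisms: univalent balls as continuous sections -/

section LocalHomeo

variable {n : ℕ} {B : Set (Cn n)} {F : Cn n → Cn n} {a : Cn n} {r : ℝ}

/-- `F` is a local homeomorphism at every point of the open set `B`. -/
structure IsLocalHomeoOn (F : Cn n → Cn n) (B : Set (Cn n)) : Prop where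
  isOpen : IsOpen B
  continuousOn : ContinuousOn F B
  locally_injOn : ∀ z ∈ B, ∃ U ∈ 𝓝 z, InjOn F U
  nhds_le_map : ∀ z ∈ B, 𝓝 (F z) ≤ map F (𝓝 z)

/-- `G` is a continuous right inverse of `F` on the ball of radius `r` about `F a`, with values in
`B` and sending `F a` to `a`. -/
structure IsSectionOn (F : Cn n → Cn n) (B : Set (Cn n)) (a : Cn n) (r : ℝ)
    (G : Cn n → Cn n) : Prop where
  continuousOn : ContinuousOn G (Metric.ball (F a) r)
  mapsTo : MapsTo G (Metric.ball (F a) r) B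
  rightInv : ∀ w ∈ Metric.ball (F a) r, F (G w) = w
  map_center : G (F a) = a

theorem IsSectionOn.mono {G : Cn n → Cn n} {s : ℝ} (hG : IsSectionOn F B a r G) (hs : s ≤ r) :
    IsSectionOn F B a s G :=
  have hsub := Metric.ball_subset_ball (x := F a) hs
  ⟨hG.continuousOn.mono hsub, hG.mapsTo.mono_left hsub, fun w hw => hG.rightInv w (hsub hw),
    hG.map_center⟩

theorem IsLocalHomeoOn.isOpen_image (hF : IsLocalHomeoOn F B) {U : Set (Cn n)} (hU : IsOpen U)
    (hUB : U ⊆ B) : IsOpen (F '' U) := by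
  rw [isOpen_iff_mem_nhds]
  rintro _ ⟨z, hz, rfl⟩
  exact hF.nhds_le_map z (hUB hz) (image_mem_map (hU.mem_nhds hz))

/-- Uniqueness of lifts: the agreement set is closed because the source is Hausdorff and open
because `F` is locally injective. -/
theorem IsLocalHomeoOn.eqOn_lift (hF : IsLocalHomeoOn F B) {S : Set (Cn n)} (hS : IsPreconnected S)
    {G₁ G₂ : Cn n → Cn n} (h₁ : ContinuousOn G₁ S) (h₂ : ContinuousOn G₂ S)
    (m₁ : MapsTo G₁ S B) (m₂ : MapsTo G₂ S B) (he : ∀ w ∈ S, F (G₁ w) = F (G₂ w))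
    {b : Cn n} (hb : b ∈ S) (hab : G₁ b = G₂ b) : EqOn G₁ G₂ S := by
  have sep : IsSeparatedMap (fun z : B => F z) := T2Space.isSeparatedMap _
  have inj : IsLocallyInjective (fun z : B => F z) := by
    rw [isLocallyInjective_iff_nhds]
    intro z
    obtain ⟨U, hU, hinj⟩ := hF.locally_injOn z z.2
    exact ⟨Subtype.val ⁻¹' U, continuous_subtype_val.continuousAt hU,
      fun x hx y hy hxy => Subtype.ext (hinj hx hy hxy)⟩
  rw [isPreconnected_iff_preconnectedSpace] at hS
  have key := sep.eq_of_comp_eq inj (A := S)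
    (g₁ := m₁.restrict G₁ S B) (g₂ := m₂.restrict G₂ S B)
    (h₁.mapsToRestrict m₁) (h₂.mapsToRestrict m₂) (funext fun w => he w w.2) ⟨b, hb⟩
    (Subtype.ext hab)
  intro w hw
  exact congrArg Subtype.val (congrFun key ⟨w, hw⟩)

/-- A section is a left inverse near each of its values. -/
theorem IsLocalHomeoOn.eventually_leftInv (hF : IsLocalHomeoOn F B) {G : Cn n → Cn n}
    (hG : IsSectionOn F B a r G) {w : Cn n} (hw : w ∈ Metric.ball (F a) r) :
    ∀ᶠ z in 𝓝 (G w), G (F z) = z ∧ F z ∈ Metric.ball (F a) r ∧ z ∈ B := by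
  have hwB := hG.mapsTo hw
  have hFG := hG.rightInv w hw
  obtain ⟨U, hU, hinj⟩ := hF.locally_injOn _ hwB
  have hFc : Tendsto F (𝓝 (G w)) (𝓝 w) := by
    have := (hF.continuousOn.continuousAt (hF.isOpen.mem_nhds hwB)).tendsto
    rwa [hFG] at this
  have hGc : Tendsto G (𝓝 w) (𝓝 (G w)) :=
    hG.continuousOn.continuousAt (Metric.isOpen_ball.mem_nhds hw)
  filter_upwards [hU, hF.isOpen.mem_nhds hwB, hFc (Metric.isOpen_ball.mem_nhds hw),
    (hGc.comp hFc) hU] with z hz hzB hzb hzU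
  exact ⟨hinj hzU hz (hG.rightInv _ hzb), hzb, hzB⟩

theorem IsLocalHomeoOn.mem_univalentRadii_of_isSectionOn (hF : IsLocalHomeoOn F B) (hr : 0 < r)
    {G : Cn n → Cn n} (hG : IsSectionOn F B a r G) : r ∈ univalentRadii B F a := by
  have hmem := Metric.mem_ball_self (x := F a) hr
  refine ⟨hr, G '' Metric.ball (F a) r, ?_, image_subset_iff.2 hG.mapsTo, ⟨F a, hmem,
    hG.map_center⟩, ?_, ?_, ?_⟩
  · rw [isOpen_iff_mem_nhds]
    rintro _ ⟨w, hw, rfl⟩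
    filter_upwards [hF.eventually_leftInv hG hw] with z hz
    exact ⟨F z, hz.2.1, hz.1⟩
  · rintro _ ⟨w, hw, rfl⟩
    rwa [hG.rightInv w hw]
  · rintro _ ⟨w, hw, rfl⟩ _ ⟨w', hw', rfl⟩ h
    rw [hG.rightInv w hw, hG.rightInv w' hw'] at h
    rw [h]
  · intro w hw
    exact ⟨G w, ⟨w, hw, rfl⟩, hG.rightInv w hw⟩

/-- Openness of `F` makes the inverse of the bijection continuous. Univalent radii are thus exactly
the radii carrying a section, and sections, unlike the sets `V`, are unique and can be glued. -/
theorem IsLocalHomeoOn.exists_isSectionOn (hF : IsLocalHomeoOn F B)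
    (h : r ∈ univalentRadii B F a) : ∃ G, IsSectionOn F B a r G := by
  obtain ⟨hr, V, hV, hVB, haV, hbij⟩ := h
  have hmaps : MapsTo (Function.invFunOn F V) (Metric.ball (F a) r) V := hbij.surjOn.mapsTo_invFunOn
  have hright : ∀ w ∈ Metric.ball (F a) r, F (Function.invFunOn F V w) = w :=
    fun w hw => hbij.surjOn.rightInvOn_invFunOn hw
  have hleft : ∀ z ∈ V, Function.invFunOn F V (F z) = z :=
    fun z hz => hbij.injOn.leftInvOn_invFunOn hz
  refine ⟨Function.invFunOn F V, ?_, hmaps.mono_right hVB, hright, hleft a haV⟩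
  intro w hw
  refine ContinuousAt.continuousWithinAt ?_
  intro U hU
  have hz := hmaps hw
  have := hF.nhds_le_map _ (hVB hz) (image_mem_map (inter_mem hU (hV.mem_nhds hz)))
  rw [hright w hw] at this
  rw [mem_map]
  filter_upwards [this]
  rintro _ ⟨z, hz, rfl⟩
  change Function.invFunOn F V (F z) ∈ U
  rw [hleft z hz.2]
  exact hz.1

theorem IsLocalHomeoOn.mem_univalentRadii_of_injOn (hF : IsLocalHomeoOn F B) (hr : 0 < r)
    {U : Set (Cn n)} (hU : IsOpen U) (hUB : U ⊆ B) (haU : a ∈ U) (hinj : InjOn F U)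
    (hball : Metric.ball (F a) r ⊆ F '' U) : r ∈ univalentRadii B F a := by
  refine ⟨hr, U ∩ F ⁻¹' Metric.ball (F a) r,
    (hF.continuousOn.mono hUB).isOpen_inter_preimage hU Metric.isOpen_ball,
    inter_subset_left.trans hUB, ⟨haU, Metric.mem_ball_self (x := F a) hr⟩,
    fun z hz => mem_preimage.1 hz.2,
    hinj.mono inter_subset_left, ?_⟩
  intro w hw
  obtain ⟨z, hz, rfl⟩ := hball hw
  exact ⟨z, ⟨hz, hw⟩, rfl⟩

theorem IsLocalHomeoOn.univalentRadii_nonempty (hF : IsLocalHomeoOn F B) (ha : a ∈ B) :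
    (univalentRadii B F a).Nonempty := by
  obtain ⟨U, hU, hinj⟩ := hF.locally_injOn a ha
  obtain ⟨W, hWU, hW, haW⟩ := mem_nhds_iff.1 (inter_mem hU (hF.isOpen.mem_nhds ha))
  have hWB : W ⊆ B := hWU.trans inter_subset_right
  obtain ⟨r, hr, hball⟩ := Metric.isOpen_iff.1 (hF.isOpen_image hW hWB) (F a) ⟨a, haW, rfl⟩
  exact ⟨r, hF.mem_univalentRadii_of_injOn hr hW hWB haW
    (hinj.mono (hWU.trans inter_subset_left)) hball⟩

/-- The supremum is attained: sections on smaller balls agree by uniqueness of lifts and glue to a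
section on the ball of radius `R`. -/
theorem IsLocalHomeoOn.isGreatest_blochRadius (hF : IsLocalHomeoOn F B) (ha : a ∈ B)
    (hbdd : BddAbove (univalentRadii B F a)) :
    IsGreatest (univalentRadii B F a) (blochRadius B F a) := by
  have hne := hF.univalentRadii_nonempty ha
  set R := blochRadius B F a with hR
  refine ⟨?_, fun r hr => le_csSup hbdd hr⟩
  have hRpos : 0 < R := by
    obtain ⟨r, hr⟩ := hne
    exact hr.1.trans_le (le_csSup hbdd hr)
  have hlt : ∀ r, r < R → ∃ G, IsSectionOn F B a r G := by
    intro r hr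
    obtain ⟨s, hs, hrs⟩ := exists_lt_of_lt_csSup hne hr
    obtain ⟨G, hG⟩ := hF.exists_isSectionOn hs
    exact ⟨G, hG.mono hrs.le⟩
  choose! G hG using hlt
  have hagree : ∀ s t, 0 < s → s ≤ t → t < R → EqOn (G s) (G t) (Metric.ball (F a) s) := by
    intro s t hs hst ht
    have h₁ := hG s (hst.trans_lt ht)
    have h₂ := (hG t ht).mono hst
    exact hF.eqOn_lift (convex_ball _ _).isPreconnected h₁.continuousOn h₂.continuousOn
      h₁.mapsTo h₂.mapsTo (fun w hw => (h₁.rightInv w hw).trans (h₂.rightInv w hw).symm)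
      (Metric.mem_ball_self hs) (h₁.map_center.trans h₂.map_center.symm)
  -- A radius strictly between `dist w (F a)` and `R`; it selects the section used at `w`.
  set m : Cn n → ℝ := fun w => (dist w (F a) + R) / 2 with hm
  have hm_pos : ∀ w, 0 < m w := fun w => by
    have := dist_nonneg (x := w) (y := F a)
    simp only [hm]; linarith
  have hm_mem : ∀ w ∈ Metric.ball (F a) R, m w < R ∧ w ∈ Metric.ball (F a) (m w) := by
    intro w hw
    rw [Metric.mem_ball] at hw ⊢
    constructor <;> simp only [hm] <;> linarith
  have heq : ∀ w ∈ Metric.ball (F a) R, ∀ v ∈ Metric.ball (F a) (m w), G (m v) v = G (m w) v := by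
    intro w hw v hv
    have hvR : v ∈ Metric.ball (F a) R := Metric.ball_subset_ball (hm_mem w hw).1.le hv
    rcases le_total (m v) (m w) with h | h
    · exact hagree _ _ (hm_pos v) h (hm_mem w hw).1 (hm_mem v hvR).2
    · exact (hagree _ _ (hm_pos w) h (hm_mem v hvR).1 hv).symm
  refine hF.mem_univalentRadii_of_isSectionOn hRpos (G := fun w => G (m w) w) ⟨?_, ?_, ?_, ?_⟩
  · intro w hw
    have hnhds := Metric.isOpen_ball.mem_nhds (hm_mem w hw).2
    have hc := (hG _ (hm_mem w hw).1).continuousOn.continuousAt hnhds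
    refine (hc.congr ?_).continuousWithinAt
    filter_upwards [hnhds] with v hv
    exact (heq w hw v hv).symm
  · exact fun w hw => (hG _ (hm_mem w hw).1).mapsTo (hm_mem w hw).2
  · exact fun w hw => (hG _ (hm_mem w hw).1).rightInv w (hm_mem w hw).2
  · exact (hG _ (hm_mem _ (Metric.mem_ball_self hRpos)).1).map_center

/-- A section that extends continuously to the closed ball extends to a larger ball. -/
theorem IsLocalHomeoOn.exists_gt_mem_univalentRadii (hF : IsLocalHomeoOn F B) (hr : 0 < r)
    {G : Cn n → Cn n} (hc : ContinuousOn G (Metric.closedBall (F a) r))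
    (hm : MapsTo G (Metric.closedBall (F a) r) B)
    (hright : ∀ w ∈ Metric.closedBall (F a) r, F (G w) = w) (hGa : G (F a) = a) :
    ∃ s ∈ univalentRadii B F a, r < s := by
  have hcpt := isCompact_closedBall (F a) r
  have hK := hcpt.image_of_continuousOn hc
  set K := G '' Metric.closedBall (F a) r
  have hKB : K ⊆ B := image_subset_iff.2 hm
  have hinjK : InjOn F K := by
    rintro _ ⟨w, hw, rfl⟩ _ ⟨w', hw', rfl⟩ h
    rw [hright w hw, hright w' hw'] at h
    rw [h]
  -- A locally injective map that is injective on a compact set is injective near that set.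
  obtain ⟨U, hU, hinj⟩ := hinjK.exists_mem_nhdsSet hK
    (fun z hz => hF.continuousOn.continuousAt (hF.isOpen.mem_nhds (hKB hz)))
    (fun z hz => hF.locally_injOn z (hKB hz))
  obtain ⟨W, hW, hKW, hWU⟩ := mem_nhdsSet_iff_exists.1 hU
  have hWB := hW.inter hF.isOpen
  have hsub : Metric.closedBall (F a) r ⊆ F '' (W ∩ B) := fun w hw =>
    ⟨G w, ⟨hKW ⟨w, hw, rfl⟩, hm hw⟩, hright w hw⟩
  obtain ⟨δ, hδ, hδsub⟩ := hcpt.exists_thickening_subset_open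
    (hF.isOpen_image hWB inter_subset_right) hsub
  rw [thickening_closedBall hδ hr.le] at hδsub
  have haK : a ∈ K := ⟨F a, Metric.mem_closedBall_self hr.le, hGa⟩
  exact ⟨δ + r, hF.mem_univalentRadii_of_injOn (by positivity) hWB inter_subset_right
    ⟨hKW haK, hKB haK⟩ (hinj.mono (inter_subset_left.trans hWU)) hδsub, by linarith⟩

end LocalHomeo

/-! ### Schwarz-Pick growth estimates on the disc -/

section SchwarzPick

theorem normSq_one_sub_conj_mul_sub (c s : ℂ) :
    ‖1 - (starRingEnd ℂ) c * s‖ ^ 2 - ‖s - c‖ ^ 2 = (1 - ‖s‖ ^ 2) * (1 - ‖c‖ ^ 2) := by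
  simp only [← Complex.normSq_eq_norm_sq, Complex.normSq_apply]
  simp
  ring

/-- The Schwarz-Pick estimate for the growth of a holomorphic self-map of the unit disc. -/
theorem norm_le_of_mapsTo_unitDisc {φ : ℂ → ℂ} (hd : DifferentiableOn ℂ φ (Metric.ball 0 1))
    (hφ : ∀ l ∈ Metric.ball (0 : ℂ) 1, ‖φ l‖ ≤ 1) {x : ℝ} (hx : ‖φ 0‖ ≤ x)
    (hx1 : x ≤ 1) {l : ℂ} (hl : l ∈ Metric.ball (0 : ℂ) 1) :
    ‖φ l‖ ≤ (‖l‖ + x) / (1 + x * ‖l‖) := by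
  have hx0 : 0 ≤ x := (norm_nonneg _).trans hx
  have hl1 : ‖l‖ < 1 := by simpa using hl
  have hl0 := norm_nonneg l
  rw [le_div_iff₀ (by positivity)]
  -- For `x = 1` the bound is the constant 1; otherwise `‖φ 0‖ < 1` and a disc automorphism can move
  -- `φ 0` to 0 for the Schwarz lemma.
  rcases hx1.eq_or_lt with rfl | hx1
  · nlinarith [hφ l hl]
  have hc1 : ‖φ 0‖ < 1 := hx.trans_lt hx1
  have hc0 := norm_nonneg (φ 0)
  set c := φ 0
  have hlow : ∀ m ∈ Metric.ball (0 : ℂ) 1, 1 - ‖c‖ * ‖φ m‖ ≤ ‖1 - (starRingEnd ℂ) c * φ m‖ := by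
    intro m hm
    have := norm_sub_norm_le (1 : ℂ) ((starRingEnd ℂ) c * φ m)
    simpa using this
  have hpos : ∀ m ∈ Metric.ball (0 : ℂ) 1, 0 < 1 - ‖c‖ * ‖φ m‖ := by
    intro m hm
    nlinarith [hφ m hm, norm_nonneg (φ m)]
  have hne : ∀ m ∈ Metric.ball (0 : ℂ) 1, 1 - (starRingEnd ℂ) c * φ m ≠ 0 := fun m hm =>
    norm_pos_iff.1 ((hpos m hm).trans_le (hlow m hm))
  have hψd : DifferentiableOn ℂ (fun m => (φ m - c) / (1 - (starRingEnd ℂ) c * φ m))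
      (Metric.ball 0 1) :=
    (hd.sub_const c).div ((hd.const_mul _).const_sub 1) hne
  have hid := fun m => normSq_one_sub_conj_mul_sub c (φ m)
  have hψm : MapsTo (fun m => (φ m - c) / (1 - (starRingEnd ℂ) c * φ m)) (Metric.ball 0 1)
      (Metric.closedBall ((φ 0 - c) / (1 - (starRingEnd ℂ) c * φ 0)) 1) := by
    intro m hm
    have : φ 0 - c = 0 := sub_self _
    simp only [this, zero_div, mem_closedBall_zero_iff, norm_div]
    refine div_le_one_of_le₀ ?_ (norm_nonneg _)
    refine (sq_le_sq₀ (norm_nonneg _) (norm_nonneg _)).1 ?_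
    have h1 : 0 ≤ 1 - ‖φ m‖ ^ 2 := by nlinarith [hφ m hm, norm_nonneg (φ m)]
    have h2 : 0 ≤ 1 - ‖c‖ ^ 2 := by nlinarith
    nlinarith [hid m, mul_nonneg h1 h2]
  have hS := Complex.dist_le_div_mul_dist_of_mapsTo_ball hψd hψm hl
  have h0 : φ 0 - c = 0 := sub_self _
  simp only [h0, zero_div, dist_zero_right, norm_div, div_one, one_mul] at hS
  rw [div_le_iff₀ ((hpos l hl).trans_le (hlow l hl))] at hS
  have hs0 := norm_nonneg (φ l)
  have hs1 := hφ l hl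
  have hS2 : ‖φ l - c‖ ^ 2 ≤ ‖l‖ ^ 2 * ‖1 - (starRingEnd ℂ) c * φ l‖ ^ 2 := by
    rw [← mul_pow]
    exact pow_le_pow_left₀ (norm_nonneg _) hS 2
  have hD2 : (1 - ‖c‖ * ‖φ l‖) ^ 2 ≤ ‖1 - (starRingEnd ℂ) c * φ l‖ ^ 2 :=
    pow_le_pow_left₀ (hpos l hl).le (hlow l hl) 2
  have hl2 : 0 ≤ 1 - ‖l‖ ^ 2 := by nlinarith
  have hsq : (‖φ l‖ - ‖c‖) ^ 2 ≤ (‖l‖ * (1 - ‖c‖ * ‖φ l‖)) ^ 2 := by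
    nlinarith [hid l, mul_le_mul_of_nonneg_left hD2 hl2]
  have hlin : ‖φ l‖ - ‖c‖ ≤ ‖l‖ * (1 - ‖c‖ * ‖φ l‖) :=
    abs_le_of_sq_le_sq' hsq (mul_nonneg hl0 (hpos l hl).le) |>.2
  have hcs : 0 ≤ 1 - ‖l‖ * ‖φ l‖ := by nlinarith
  -- `hlin` reads `‖φ l‖ - ‖l‖ ≤ ‖c‖ * (1 - ‖l‖ * ‖φ l‖)`, whose right side increases with `‖c‖`.
  nlinarith [mul_le_mul_of_nonneg_right hx hcs]

variable {F : Type*} [NormedAddCommGroup F] [NormedSpace ℂ F]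

/-- A functional norming `Q l` reduces the vector-valued estimate to the scalar one. -/
theorem norm_le_of_norm_le_unitDisc {Q : ℂ → F} (hd : DifferentiableOn ℂ Q (Metric.ball 0 1))
    {M : ℝ} (hM : 0 < M) (hQ : ∀ l ∈ Metric.ball (0 : ℂ) 1, ‖Q l‖ ≤ M) {x : ℝ}
    (hx : ‖Q 0‖ ≤ M * x) (hx1 : x ≤ 1) {l : ℂ} (hl : l ∈ Metric.ball (0 : ℂ) 1) :
    ‖Q l‖ ≤ M * ((‖l‖ + x) / (1 + x * ‖l‖)) := by
  obtain ⟨g, hg, hgl⟩ := exists_dual_vector'' ℂ (Q l)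
  have hgle : ∀ m, ‖g (Q m) / M‖ ≤ ‖Q m‖ / M := by
    intro m
    rw [norm_div, Complex.norm_real, Real.norm_of_nonneg hM.le]
    gcongr
    calc ‖g (Q m)‖ ≤ ‖g‖ * ‖Q m‖ := g.le_opNorm _
      _ ≤ 1 * ‖Q m‖ := by gcongr
      _ = ‖Q m‖ := one_mul _
  have h := norm_le_of_mapsTo_unitDisc (φ := fun m => g (Q m) / M) (x := x)
    ((g.differentiable.comp_differentiableOn hd).div_const _)
    (fun m hm => (hgle m).trans ((div_le_one hM).2 (hQ m hm)))
    ((hgle 0).trans ((div_le_iff₀ hM).2 (by linarith))) hx1 hl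
  have heq : ‖g (Q l) / M‖ = ‖Q l‖ / M := by
    rw [norm_div, hgl]
    simp [abs_of_pos hM]
  rw [heq, div_le_iff₀ hM] at h
  linarith

end SchwarzPick

/-! ### Integration of the Schwarz-Pick bound along rays -/

section Growth

/-- The antiderivative of `(t + x) / (1 + x t)` vanishing at `0`. -/
noncomputable def growth (x t : ℝ) : ℝ :=
  if x = 0 then t ^ 2 / 2 else t / x + (1 - 1 / x ^ 2) * Real.log (1 + x * t)

theorem growth_zero_right (x : ℝ) : growth x 0 = 0 := by
  unfold growth; split_ifs <;> simp

theorem mu_eq_growth (k x : ℝ) : mu k x = 1 + k * growth x 1 := by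
  unfold mu growth
  split_ifs
  · ring
  · rw [mul_one]

theorem hasDerivAt_growth {x t : ℝ} (hx : 0 ≤ x) (ht : 0 ≤ t) :
    HasDerivAt (growth x) ((t + x) / (1 + x * t)) t := by
  by_cases h : x = 0
  · subst h
    have : growth 0 = fun t => t ^ 2 / 2 := by funext t; simp [growth]
    rw [this]
    refine ((hasDerivAt_pow 2 t).div_const 2).congr_deriv ?_
    norm_num
  · have : growth x = fun t => t / x + (1 - 1 / x ^ 2) * Real.log (1 + x * t) := by
      funext t; simp [growth, h]
    rw [this]
    have hpos : 0 < 1 + x * t := by positivity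
    have h1 : HasDerivAt (fun t => 1 + x * t) x t := by
      simpa using ((hasDerivAt_id t).const_mul x).const_add 1
    refine (((hasDerivAt_id' t).div_const x).add
      ((h1.log hpos.ne').const_mul (1 - 1 / x ^ 2))).congr_deriv ?_
    field_simp
    ring

theorem monotoneOn_growth {x : ℝ} (hx : 0 ≤ x) : MonotoneOn (growth x) (Ici 0) := by
  refine monotoneOn_of_deriv_nonneg (convex_Ici 0)
    (fun t ht => (hasDerivAt_growth hx ht).continuousAt.continuousWithinAt)
    (fun t ht => ?_) (fun t ht => ?_) <;> rw [interior_Ici] at ht <;> have ht : 0 < t := ht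
  · exact (hasDerivAt_growth hx ht.le).differentiableAt.differentiableWithinAt
  · rw [(hasDerivAt_growth hx ht.le).deriv]
    positivity

variable {E : Type*} [NormedAddCommGroup E] [NormedSpace ℂ E]
variable {F : Type*} [NormedAddCommGroup F] [NormedSpace ℂ F] [CompleteSpace F]

/-- Restrict `ψ` to the complex disc `l ↦ c + l • d` with `‖d‖ = R` that passes through `w`. Its
derivative is at most `k * R`, and at most `k * R * x` at 0, so Schwarz-Pick applies to it. -/
theorem norm_sub_le_growth {ψ : E → F} {c : E} {R k x : ℝ} (hk : 0 < k)
    (hd : DifferentiableOn ℂ ψ (Metric.ball c R))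
    (hψ : ∀ w ∈ Metric.ball c R, ‖fderiv ℂ ψ w‖ ≤ k) (hx : ‖fderiv ℂ ψ c‖ ≤ k * x)
    (hx0 : 0 ≤ x) (hx1 : x ≤ 1) {w : E} (hw : w ∈ Metric.ball c R) :
    ‖ψ w - ψ c‖ ≤ k * R * growth x 1 := by
  have hR : 0 < R := dist_nonneg.trans_lt hw
  have hg0 : ∀ t, 0 ≤ t → 0 ≤ growth x t := fun t ht => by
    rw [← growth_zero_right x]
    exact monotoneOn_growth hx0 (mem_Ici.2 le_rfl) ht ht
  rcases eq_or_ne w c with rfl | hwc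
  · rw [sub_self, norm_zero]
    exact mul_nonneg (by positivity) (hg0 1 zero_le_one)
  have hs : 0 < ‖w - c‖ := norm_pos_iff.2 (sub_ne_zero.2 hwc)
  have hsR : ‖w - c‖ < R := by rwa [Metric.mem_ball, dist_eq_norm] at hw
  set t : ℝ := ‖w - c‖ / R with ht
  have ht0 : 0 < t := by positivity
  have ht1 : t < 1 := (div_lt_one hR).2 hsR
  set d : E := ((t⁻¹ : ℝ) : ℂ) • (w - c) with hdd
  have hdn : ‖d‖ = R := by
    rw [hdd, norm_smul, Complex.norm_real, Real.norm_of_nonneg (by positivity), ht]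
    field_simp
  have hwd : c + (t : ℂ) • d = w := by
    rw [hdd, smul_smul, ← Complex.ofReal_mul, mul_inv_cancel₀ ht0.ne']
    simp
  set q : ℂ → F := fun l => ψ (c + l • d)
  have hmem : ∀ l ∈ Metric.ball (0 : ℂ) 1, c + l • d ∈ Metric.ball c R := by
    intro l hl
    rw [mem_ball_zero_iff] at hl
    rw [mem_ball_iff_norm, add_sub_cancel_left, norm_smul, hdn]
    nlinarith
  have hline : ∀ l : ℂ, HasDerivAt (fun l : ℂ => c + l • d) d l := fun l => by
    simpa using ((hasDerivAt_id l).smul_const d).const_add c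
  have hq : ∀ l ∈ Metric.ball (0 : ℂ) 1, HasDerivAt q (fderiv ℂ ψ (c + l • d) d) l := by
    intro l hl
    have hψl := (hd.differentiableAt (Metric.isOpen_ball.mem_nhds (hmem l hl))).hasFDerivAt
    exact hψl.comp_hasDerivAt l (hline l)
  have hqd : DifferentiableOn ℂ q (Metric.ball 0 1) := fun l hl =>
    (hq l hl).differentiableAt.differentiableWithinAt
  have hQ : DifferentiableOn ℂ (deriv q) (Metric.ball 0 1) := hqd.deriv Metric.isOpen_ball
  have hQb : ∀ l ∈ Metric.ball (0 : ℂ) 1, ‖deriv q l‖ ≤ k * R := by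
    intro l hl
    rw [(hq l hl).deriv, ← hdn]
    exact ((fderiv ℂ ψ (c + l • d)).le_opNorm d).trans
      (mul_le_mul_of_nonneg_right (hψ _ (hmem l hl)) (norm_nonneg _))
  have hQ0 : ‖deriv q 0‖ ≤ k * R * x := by
    rw [(hq 0 (Metric.mem_ball_self one_pos)).deriv, zero_smul, add_zero]
    calc _ ≤ ‖fderiv ℂ ψ c‖ * ‖d‖ := (fderiv ℂ ψ c).le_opNorm d
      _ ≤ k * x * R := by rw [hdn]; gcongr
      _ = _ := by ring
  have hreal : ∀ s ∈ Icc 0 t, ((s : ℝ) : ℂ) ∈ Metric.ball (0 : ℂ) 1 := by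
    intro s hs
    rw [mem_ball_zero_iff, Complex.norm_real, Real.norm_of_nonneg hs.1]
    exact hs.2.trans_lt ht1
  have hder : ∀ s ∈ Icc 0 t, HasDerivAt (fun s : ℝ => q s - ψ c) (deriv q s) s := by
    intro s hs
    have h := (hqd.differentiableAt (Metric.isOpen_ball.mem_nhds (hreal s hs))).hasDerivAt
    have h' := h.scomp s (Complex.ofRealCLM.hasDerivAt (x := s))
    simpa using h'.sub_const (ψ c)
  have hB : ∀ s ∈ Icc 0 t, HasDerivAt (fun s => k * R * growth x s)
      (k * R * ((s + x) / (1 + x * s))) s := fun s hs =>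
    (hasDerivAt_growth hx0 hs.1).const_mul _
  -- Comparison of derivatives replaces integration of `(s + x) / (1 + x * s)`.
  have hmain := image_norm_le_of_norm_deriv_right_le_deriv_boundary' (a := 0) (b := t)
    (fun s hs => (hder s hs).continuousAt.continuousWithinAt)
    (fun s hs => (hder s (Ico_subset_Icc_self hs)).hasDerivWithinAt)
    (B := fun s => k * R * growth x s) (by simp [q, growth_zero_right])
    (fun s hs => (hB s hs).continuousAt.continuousWithinAt)
    (fun s hs => (hB s (Ico_subset_Icc_self hs)).hasDerivWithinAt)
    (fun s hs => by
      have h := norm_le_of_norm_le_unitDisc hQ (by positivity) hQb hQ0 hx1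
        (hreal s (Ico_subset_Icc_self hs))
      rwa [Complex.norm_real, Real.norm_of_nonneg hs.1] at h)
    (right_mem_Icc.2 ht0.le)
  simp only [q, hwd] at hmain
  refine hmain.trans ?_
  gcongr
  exact monotoneOn_growth hx0 ht0.le (mem_Ici.2 zero_le_one) ht1.le

end Growth

/-! ### Values and limits of `mu` -/

section Mu

/-- Follows from `log (1 + x) ≥ x / (1 + x)`, because the coefficient of the logarithm is
nonpositive. -/
theorem growth_le_one {x : ℝ} (hx0 : 0 ≤ x) (hx1 : x ≤ 1) : growth x 1 ≤ 1 := by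
  unfold growth
  split_ifs with h
  · norm_num
  · have hx : 0 < x := lt_of_le_of_ne hx0 (Ne.symm h)
    have hlog := Real.one_sub_inv_le_log_of_pos (show (0 : ℝ) < 1 + x by positivity)
    have h1 : 0 ≤ 1 / x ^ 2 - 1 := by
      rw [sub_nonneg, le_div_iff₀ (by positivity)]
      nlinarith
    have h2 := mul_le_mul_of_nonneg_left hlog h1
    have h3 : (1 / x ^ 2 - 1) * (1 - (1 + x)⁻¹) = 1 / x - 1 := by
      field_simp
      ring
    rw [mul_one]
    linarith

theorem growth_one_one : growth 1 1 = 1 := by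
  simp [growth]

theorem mu_one (k : ℝ) : mu k 1 = 1 + k := by
  rw [mu_eq_growth, growth_one_one, mul_one]

theorem mu_le_mu_one {k x : ℝ} (hk : 0 ≤ k) (hx0 : 0 ≤ x) (hx1 : x ≤ 1) : mu k x ≤ mu k 1 := by
  rw [mu_eq_growth, mu_eq_growth, growth_one_one]
  gcongr
  exact growth_le_one hx0 hx1

theorem tendsto_growth_one : Tendsto (fun x => growth x 1) (𝓝[>] 0) (𝓝 (1 / 2)) := by
  have hkey : ∀ᶠ x : ℝ in 𝓝[>] 0, |growth x 1 - 1 / 2| ≤ 4 * x := by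
    filter_upwards [Ioo_mem_nhdsGT (show (0 : ℝ) < 1 / 2 by norm_num)] with x hx
    have hx0 := hx.1
    have hx2 := hx.2
    -- The second-order expansion of `log (1 + x)` has a cubic error, which is still O(x) after
    -- division by `x ^ 2`.
    have h := Real.abs_log_sub_add_sum_range_le (x := -x) (by rw [abs_neg, abs_of_pos hx0]; linarith) 2
    simp only [Finset.sum_range_succ, Finset.sum_range_zero, abs_neg, abs_of_pos hx0,
      sub_neg_eq_add] at h
    norm_num at h
    have hb : x ^ 3 / (1 - x) ≤ 2 * x ^ 3 := by
      rw [div_le_iff₀ (by linarith)]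
      nlinarith [pow_pos hx0 3]
    set e := -x + x ^ 2 / 2 + Real.log (1 + x) with he
    have h' : |e| ≤ 2 * x ^ 3 := h.trans hb
    have hlog : Real.log (1 + x) = e + x - x ^ 2 / 2 := by rw [he]; ring
    have heq : growth x 1 - 1 / 2 = (x - x ^ 2 / 2) - (1 - x ^ 2) * (e / x ^ 2) := by
      rw [growth, if_neg hx0.ne', mul_one, hlog]
      field_simp
      ring
    have hex : |e / x ^ 2| ≤ 2 * x := by
      rw [abs_div, abs_of_pos (by positivity : 0 < x ^ 2), div_le_iff₀ (by positivity)]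
      linarith
    rw [heq, abs_le]
    obtain ⟨h1, h2⟩ := abs_le.1 hex
    constructor <;> nlinarith
  rw [tendsto_iff_dist_tendsto_zero]
  refine squeeze_zero' (Eventually.of_forall fun _ => dist_nonneg) (g := fun x => 4 * x) ?_ ?_
  · simpa only [Real.dist_eq] using hkey
  · have : Tendsto (fun x : ℝ => 4 * x) (𝓝 0) (𝓝 (4 * 0)) := (continuous_const_mul 4).tendsto 0
    rw [mul_zero] at this
    exact this.mono_left nhdsWithin_le_nhds

theorem mu_zero (k : ℝ) : mu k 0 = 1 + k / 2 := by simp [mu]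

theorem tendsto_mu_zero (k : ℝ) : Tendsto (mu k) (𝓝[>] 0) (𝓝 (mu k 0)) := by
  have h := (tendsto_growth_one.const_mul k).const_add 1
  rw [mu_zero, show 1 + k / 2 = 1 + k * (1 / 2) by ring]
  exact h.congr fun x => (mu_eq_growth k x).symm

theorem tendsto_mu_of_param_zero (x : ℝ) : Tendsto (fun k => mu k x) (𝓝[>] 0) (𝓝 1) := by
  simp only [mu_eq_growth]
  have h : Tendsto (fun k : ℝ => 1 + k * growth x 1) (𝓝 0) (𝓝 (1 + 0 * growth x 1)) :=
    Continuous.tendsto (by fun_prop) 0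
  rw [zero_mul, add_zero] at h
  exact h.mono_left nhdsWithin_le_nhds

end Mu

variable {n : ℕ}

/-! ### Coordinatewise conjugation -/

section Conj

theorem norm_conjVec (v : Cn n) : ‖conjVec v‖ = ‖v‖ := by
  simp [conjVec, EuclideanSpace.norm_eq]

theorem conjVec_sub (v w : Cn n) : conjVec (v - w) = conjVec v - conjVec w := by
  ext i; simp [conjVec]

theorem conjVec_smul (c : ℂ) (v : Cn n) :
    conjVec (c • v) = (starRingEnd ℂ) c • conjVec v := by
  ext i; simp [conjVec]

theorem conjVec_conjVec (v : Cn n) : conjVec (conjVec v) = v := by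
  ext i; simp [conjVec]

theorem continuous_conjVec : Continuous (conjVec : Cn n → Cn n) := by
  refine continuous_iff_continuousAt.2 fun v => ?_
  rw [ContinuousAt, tendsto_iff_norm_sub_tendsto_zero]
  simp only [← conjVec_sub, norm_conjVec]
  exact tendsto_iff_norm_sub_tendsto_zero.1 tendsto_id

end Conj

/-! ### Perturbations of the identity by a conjugated contraction -/

section Perturbation

/-- The map `w ↦ w + conj (ψ w)`. -/
def addConj (ψ : Cn n → Cn n) : Cn n → Cn n := fun w => w + conjVec (ψ w)

variable {ψ : Cn n → Cn n} {c : Cn n} {r k : ℝ}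

theorem norm_sub_le_of_fderiv_le (hd : DifferentiableOn ℂ ψ (Metric.ball c r))
    (hψ : ∀ w ∈ Metric.ball c r, ‖fderiv ℂ ψ w‖ ≤ k) {v w : Cn n} (hv : v ∈ Metric.ball c r)
    (hw : w ∈ Metric.ball c r) : ‖ψ v - ψ w‖ ≤ k * ‖v - w‖ :=
  (convex_ball c r).norm_image_sub_le_of_norm_fderiv_le
    (fun _ hx => hd.differentiableAt (Metric.isOpen_ball.mem_nhds hx)) hψ hw hv

/-- Conjugation is an isometry but only real-linear, so the inverse function theorem is applied over
ℝ. -/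
theorem approximatesLinearOn_addConj (hk : 0 ≤ k)
    (hd : DifferentiableOn ℂ ψ (Metric.ball c r))
    (hψ : ∀ w ∈ Metric.ball c r, ‖fderiv ℂ ψ w‖ ≤ k) :
    ApproximatesLinearOn (addConj ψ) (ContinuousLinearEquiv.refl ℝ (Cn n) : Cn n →L[ℝ] Cn n)
      (Metric.ball c r) ⟨k, hk⟩ := by
  intro v hv w hw
  have : addConj ψ v - addConj ψ w
      - (ContinuousLinearEquiv.refl ℝ (Cn n) : Cn n →L[ℝ] Cn n) (v - w)
      = conjVec (ψ v - ψ w) := by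
    simp only [addConj, conjVec_sub, ContinuousLinearEquiv.coe_refl, ContinuousLinearMap.id_apply]
    abel
  rw [this, norm_conjVec]
  exact norm_sub_le_of_fderiv_le hd hψ hv hw

theorem subsingleton_or_lt_inv_nnnorm_refl_symm (hk : 0 ≤ k) (hk1 : k < 1) :
    Subsingleton (Cn n) ∨
      (⟨k, hk⟩ : NNReal) < ‖((ContinuousLinearEquiv.refl ℝ (Cn n)).symm : Cn n →L[ℝ] Cn n)‖₊⁻¹ := by
  rcases subsingleton_or_nontrivial (Cn n) with h | h
  · exact Or.inl h
  · right
    have h1 : ‖((ContinuousLinearEquiv.refl ℝ (Cn n)).symm : Cn n →L[ℝ] Cn n)‖₊ = 1 := by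
      rw [ContinuousLinearEquiv.refl_symm, ContinuousLinearEquiv.coe_refl]
      exact ContinuousLinearMap.nnnorm_id
    rw [h1, inv_one]
    exact_mod_cast hk1

/-- If `‖Dψ‖ ≤ k < 1`, then `w ↦ w + conj (ψ w)` maps a subset of the ball of radius `r`
homeomorphically onto the ball of radius `(1 - k) r`. -/
theorem exists_rightInv_addConj (hk : 0 ≤ k) (hk1 : k < 1) (hr : 0 < r)
    (hd : DifferentiableOn ℂ ψ (Metric.ball c r))
    (hψ : ∀ w ∈ Metric.ball c r, ‖fderiv ℂ ψ w‖ ≤ k) :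
    ∃ S : Cn n → Cn n, ContinuousOn S (Metric.ball (addConj ψ c) ((1 - k) * r)) ∧
      MapsTo S (Metric.ball (addConj ψ c) ((1 - k) * r)) (Metric.ball c r) ∧
      (∀ w ∈ Metric.ball (addConj ψ c) ((1 - k) * r), addConj ψ (S w) = w) ∧
      S (addConj ψ c) = c := by
  have happ := approximatesLinearOn_addConj hk hd hψ
  have hsub := subsingleton_or_lt_inv_nnnorm_refl_symm (n := n) hk hk1
  set e := happ.toOpenPartialHomeomorph (addConj ψ) _ hsub Metric.isOpen_ball with he
  have hcoe : ∀ w, e w = addConj ψ w := fun w => rfl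
  have hsource : e.source = Metric.ball c r := rfl
  have htarget : Metric.ball (addConj ψ c) ((1 - k) * r) ⊆ e.target := by
    intro y hy
    have h1k : 0 < 1 - k := by linarith
    set ε := dist y (addConj ψ c) / (1 - k) with hε
    have hε0 : 0 ≤ ε := by positivity
    have hεr : ε < r := by
      rw [hε, div_lt_iff₀ h1k]
      have := Metric.mem_ball.1 hy
      linarith
    -- With bound exactly 1, the surjectivity radius is `(1⁻¹ - k) * ε`, which is the distance from
    -- `y` to the centre by the choice of `ε`.
    let f'symm : (ContinuousLinearEquiv.refl ℝ (Cn n) : Cn n →L[ℝ] Cn n).NonlinearRightInverse :=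
      { toFun := id, nnnorm := 1, bound' := fun y => by simp, right_inv' := fun y => rfl }
    have hsurj := happ.surjOn_closedBall_of_nonlinearRightInverse f'symm hε0
      (Metric.closedBall_subset_ball hεr)
    have hy' : y ∈ Metric.closedBall (addConj ψ c)
        (((f'symm.nnnorm : ℝ)⁻¹ - (⟨k, hk⟩ : NNReal)) * ε) := by
      simp only [f'symm, Metric.mem_closedBall, NNReal.coe_one, inv_one]
      rw [hε, mul_div_cancel₀ _ h1k.ne']
    obtain ⟨w, hw, rfl⟩ := hsurj hy'
    exact e.map_source (show w ∈ e.source from Metric.closedBall_subset_ball hεr hw)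
  refine ⟨e.symm, e.continuousOn_symm.mono htarget, fun w hw => e.map_target (htarget hw),
    fun w hw => e.right_inv (htarget hw), e.left_inv (Metric.mem_ball_self hr)⟩

end Perturbation

/-! ### The class PH(k) in the coordinate given by `h` -/

section PH

variable {B : Set (Cn n)} {h g : Cn n → Cn n} {k : ℝ}

theorem IsLocallyBiholomorphic.isLocalHomeoOn (hh : IsLocallyBiholomorphic h B) (hB : IsOpen B) :
    IsLocalHomeoOn h B := by
  refine ⟨hB, ?_, ?_, ?_⟩
  · intro z hz
    obtain ⟨U, V, hzU, hUB, hUV⟩ := hh z hz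
    exact (hUV.holomorphic.continuousOn.continuousAt
      (hUV.isOpen_source.mem_nhds hzU)).continuousWithinAt
  · intro z hz
    obtain ⟨U, V, hzU, hUB, hUV⟩ := hh z hz
    exact ⟨U, hUV.isOpen_source.mem_nhds hzU, hUV.bijOn.injOn⟩
  · intro z hz
    obtain ⟨U, V, hzU, hUB, hUV⟩ := hh z hz
    obtain ⟨ψ, hψ, hleft⟩ := hUV.holomorphic_inverse
    have hzV := hUV.bijOn.mapsTo hzU
    have hψc : Tendsto ψ (𝓝 (h z)) (𝓝 z) := by
      have := (hψ.continuousOn.continuousAt (hUV.isOpen_target.mem_nhds hzV)).tendsto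
      rwa [hleft hzU] at this
    intro W hW
    rw [mem_map] at hW
    filter_upwards [hψc hW, hUV.isOpen_target.mem_nhds hzV] with w hw hwV
    obtain ⟨u, hu, rfl⟩ := hUV.bijOn.surjOn hwV
    have : h (ψ (h u)) ∈ W := hw
    rwa [hleft hu] at this

/-- Continuous sections of a locally biholomorphic map are holomorphic, and their derivative is the
inverse of the derivative of the map. -/
theorem IsLocallyBiholomorphic.hasFDerivAt_section (hh : IsLocallyBiholomorphic h B)
    (hB : IsOpen B) {a : Cn n} {r : ℝ} {Φ : Cn n → Cn n} (hΦ : IsSectionOn h B a r Φ) {w : Cn n}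
    (hw : w ∈ Metric.ball (h a) r) :
    HasFDerivAt Φ (fderiv ℂ h (Φ w)).inverse w ∧
      (fderiv ℂ h (Φ w)).comp (fderiv ℂ h (Φ w)).inverse = ContinuousLinearMap.id ℂ (Cn n) := by
  have hF := hh.isLocalHomeoOn hB
  obtain ⟨U, V, hzU, hUB, hUV⟩ := hh (Φ w) (hΦ.mapsTo hw)
  obtain ⟨ψ, hψ, hleft⟩ := hUV.holomorphic_inverse
  have hwV : w ∈ V := by
    have := hUV.bijOn.mapsTo hzU
    rwa [hΦ.rightInv w hw] at this
  have hnw := Metric.isOpen_ball.mem_nhds hw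
  have hΦc : Tendsto Φ (𝓝 w) (𝓝 (Φ w)) := hΦ.continuousOn.continuousAt hnw
  have heq : Φ =ᶠ[𝓝 w] ψ := by
    filter_upwards [hΦc (hUV.isOpen_source.mem_nhds hzU), hnw] with v hv hvb
    have := hleft hv
    rw [hΦ.rightInv v hvb] at this
    exact this.symm
  have hΦd : HasFDerivAt Φ (fderiv ℂ ψ w) w :=
    ((hψ.differentiableAt (hUV.isOpen_target.mem_nhds hwV)).hasFDerivAt).congr_of_eventuallyEq heq
  have hhd : HasFDerivAt h (fderiv ℂ h (Φ w)) (Φ w) :=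
    (hUV.holomorphic.differentiableAt (hUV.isOpen_source.mem_nhds hzU)).hasFDerivAt
  have hright : (fderiv ℂ h (Φ w)).comp (fderiv ℂ ψ w) = ContinuousLinearMap.id ℂ (Cn n) := by
    have h1 : HasFDerivAt (h ∘ Φ) ((fderiv ℂ h (Φ w)).comp (fderiv ℂ ψ w)) w := hhd.comp w hΦd
    refine h1.unique ((hasFDerivAt_id w).congr_of_eventuallyEq ?_)
    filter_upwards [hnw] with v hv using hΦ.rightInv v hv
  have hleft' : (fderiv ℂ ψ w).comp (fderiv ℂ h (Φ w)) = ContinuousLinearMap.id ℂ (Cn n) := by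
    have hΦd' : HasFDerivAt Φ (fderiv ℂ ψ w) (h (Φ w)) := by rwa [hΦ.rightInv w hw]
    have h1 : HasFDerivAt (Φ ∘ h) ((fderiv ℂ ψ w).comp (fderiv ℂ h (Φ w))) (Φ w) :=
      hΦd'.comp (Φ w) hhd
    refine h1.unique ((hasFDerivAt_id (Φ w)).congr_of_eventuallyEq ?_)
    filter_upwards [hF.eventually_leftInv hΦ hw] with v hv using hv.1
  -- `inverse` has a default value off the invertible maps, so both one-sided identities are needed.
  rw [ContinuousLinearMap.inverse_eq hright hleft']
  exact ⟨hΦd, hright⟩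

theorem IsPH.hasFDerivAt_comp_section (hf : IsPH B k h g) (hB : IsOpen B) {a : Cn n} {r : ℝ}
    {Φ : Cn n → Cn n} (hΦ : IsSectionOn h B a r Φ) {w : Cn n} (hw : w ∈ Metric.ball (h a) r) :
    HasFDerivAt (g ∘ Φ) (dilatation h g (Φ w)) w :=
  (hf.holomorphic.differentiableAt (hB.mem_nhds (hΦ.mapsTo hw))).hasFDerivAt.comp w
    (hf.locally_biholomorphic.hasFDerivAt_section hB hΦ hw).1

theorem IsPH.differentiableOn_comp_section (hf : IsPH B k h g) (hB : IsOpen B) {a : Cn n} {r : ℝ}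
    {Φ : Cn n → Cn n} (hΦ : IsSectionOn h B a r Φ) :
    DifferentiableOn ℂ (g ∘ Φ) (Metric.ball (h a) r) := fun _ hw =>
  (hf.hasFDerivAt_comp_section hB hΦ hw).differentiableAt.differentiableWithinAt

theorem IsPH.norm_fderiv_comp_section_le (hf : IsPH B k h g) (hB : IsOpen B) {a : Cn n} {r : ℝ}
    {Φ : Cn n → Cn n} (hΦ : IsSectionOn h B a r Φ) :
    ∀ w ∈ Metric.ball (h a) r, ‖fderiv ℂ (g ∘ Φ) w‖ ≤ k := by
  intro w hw
  rw [(hf.hasFDerivAt_comp_section hB hΦ hw).fderiv]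
  exact hf.dilatation_le _ (hΦ.mapsTo hw)

theorem pluri_section {a : Cn n} {r : ℝ} {Φ : Cn n → Cn n} (hΦ : IsSectionOn h B a r Φ)
    {w : Cn n} (hw : w ∈ Metric.ball (h a) r) : pluri h g (Φ w) = addConj (g ∘ Φ) w := by
  simp only [pluri, addConj, Function.comp_apply, hΦ.rightInv w hw]

theorem addConj_section_center {a : Cn n} {r : ℝ} {Φ : Cn n → Cn n}
    (hΦ : IsSectionOn h B a r Φ) : addConj (g ∘ Φ) (h a) = pluri h g a := by
  simp only [pluri, addConj, Function.comp_apply, hΦ.map_center]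

/-- Near each point the map is `addConj (g ∘ Φ) ∘ h`, a composition of local homeomorphisms. -/
theorem IsPH.isLocalHomeoOn (hf : IsPH B k h g) (hB : IsOpen B) (hk : 0 ≤ k) (hk1 : k < 1) :
    IsLocalHomeoOn (pluri h g) B := by
  have hF := hf.locally_biholomorphic.isLocalHomeoOn hB
  have key : ∀ z ∈ B, ∃ r > 0, ∃ Φ, IsSectionOn h B z r Φ := by
    intro z hz
    obtain ⟨r, hr⟩ := hF.univalentRadii_nonempty hz
    obtain ⟨Φ, hΦ⟩ := hF.exists_isSectionOn hr
    exact ⟨r, hr.1, Φ, hΦ⟩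
  have hev : ∀ z ∈ B, ∀ r > 0, ∀ Φ, IsSectionOn h B z r Φ →
      ∀ᶠ v in 𝓝 z, pluri h g v = addConj (g ∘ Φ) (h v) ∧ h v ∈ Metric.ball (h z) r := by
    intro z hz r hr Φ hΦ
    have := hF.eventually_leftInv hΦ (Metric.mem_ball_self hr)
    rw [hΦ.map_center] at this
    filter_upwards [this] with v hv
    refine ⟨?_, hv.2.1⟩
    simp only [pluri, addConj, Function.comp_apply, hv.1]
  refine ⟨hB, ?_, ?_, ?_⟩
  · exact hF.continuousOn.add (continuous_conjVec.comp_continuousOn hf.holomorphic.continuousOn)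
  · intro z hz
    obtain ⟨r, hr, Φ, hΦ⟩ := key z hz
    have happ := approximatesLinearOn_addConj hk (hf.differentiableOn_comp_section hB hΦ)
      (hf.norm_fderiv_comp_section_le hB hΦ)
    have hinj := happ.injOn (subsingleton_or_lt_inv_nnnorm_refl_symm hk hk1)
    obtain ⟨U, hU, hUinj⟩ := hF.locally_injOn z hz
    refine ⟨_, inter_mem hU (hev z hz r hr Φ hΦ), ?_⟩
    rintro v ⟨hv, hv', hvb⟩ w ⟨hw, hw', hwb⟩ hvw
    rw [hv', hw'] at hvw
    exact hUinj hv hw (hinj hvb hwb hvw)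
  · intro z hz
    obtain ⟨r, hr, Φ, hΦ⟩ := key z hz
    have happ := approximatesLinearOn_addConj hk (hf.differentiableOn_comp_section hB hΦ)
      (hf.norm_fderiv_comp_section_le hB hΦ)
    have hmap := (happ.toOpenPartialHomeomorph _ _
      (subsingleton_or_lt_inv_nnnorm_refl_symm hk hk1) Metric.isOpen_ball).map_nhds_eq
      (x := h z) (Metric.mem_ball_self hr)
    have hmap' : map (addConj (g ∘ Φ)) (𝓝 (h z)) = 𝓝 (addConj (g ∘ Φ) (h z)) := hmap
    have hcongr : map (pluri h g) (𝓝 z) = map (addConj (g ∘ Φ)) (map h (𝓝 z)) := by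
      rw [map_map]
      exact map_congr ((hev z hz r hr Φ hΦ).mono fun v hv => hv.1)
    rw [hcongr, ← addConj_section_center hΦ, ← hmap']
    exact map_mono (hF.nhds_le_map z hz)

theorem IsPH.mul_mem_univalentRadii (hf : IsPH B k h g) (hB : IsOpen B) (hk : 0 ≤ k) (hk1 : k < 1)
    {a : Cn n} {r : ℝ} (hr : r ∈ univalentRadii B h a) :
    (1 - k) * r ∈ univalentRadii B (pluri h g) a := by
  obtain ⟨Φ, hΦ⟩ := (hf.locally_biholomorphic.isLocalHomeoOn hB).exists_isSectionOn hr
  obtain ⟨S, hSc, hSm, hSr, hSa⟩ := exists_rightInv_addConj hk hk1 hr.1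
    (hf.differentiableOn_comp_section hB hΦ) (hf.norm_fderiv_comp_section_le hB hΦ)
  rw [addConj_section_center hΦ] at hSc hSm hSr hSa
  refine (hf.isLocalHomeoOn hB hk hk1).mem_univalentRadii_of_isSectionOn
    (mul_pos (by linarith) hr.1) (G := Φ ∘ S) ⟨hΦ.continuousOn.comp hSc hSm, hΦ.mapsTo.comp hSm,
      fun w hw => ?_, ?_⟩
  · rw [Function.comp_apply, pluri_section hΦ (hSm hw), hSr w hw]
  · rw [Function.comp_apply, hSa, hΦ.map_center]

/-- An inverse branch maps a ball of radius `r` into the bounded set `B`, so the Schwarz lemma gives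
`‖Dh(a)⁻¹‖ ≤ M / r`, while `1 ≤ ‖Dh(a)‖ * ‖Dh(a)⁻¹‖` in positive dimension. -/
theorem IsLocallyBiholomorphic.bddAbove_univalentRadii (hh : IsLocallyBiholomorphic h B)
    (hB : IsOpen B) (hbd : Bornology.IsBounded B) (hn : 1 ≤ n) (a : Cn n) :
    BddAbove (univalentRadii B h a) := by
  obtain ⟨M, hM⟩ := hbd.subset_ball a
  refine ⟨‖fderiv ℂ h a‖ * M, ?_⟩
  intro r hr
  obtain ⟨Φ, hΦ⟩ := (hh.isLocalHomeoOn hB).exists_isSectionOn hr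
  have hmem := Metric.mem_ball_self (x := h a) hr.1
  have hd : DifferentiableOn ℂ Φ (Metric.ball (h a) r) := fun w hw =>
    (hh.hasFDerivAt_section hB hΦ hw).1.differentiableAt.differentiableWithinAt
  have hΦM : MapsTo Φ (Metric.ball (h a) r) (Metric.closedBall (Φ (h a)) M) := by
    rw [hΦ.map_center]
    exact fun w hw => Metric.ball_subset_closedBall (hM (hΦ.mapsTo hw))
  have h1 := Complex.norm_fderiv_le_div_of_mapsTo_ball hd hΦM hr.1
  obtain ⟨h2, h3⟩ := hh.hasFDerivAt_section hB hΦ hmem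
  rw [h2.fderiv, hΦ.map_center] at h1
  rw [hΦ.map_center] at h3
  have : Nonempty (Fin n) := ⟨⟨0, hn⟩⟩
  have h4 : 1 ≤ ‖fderiv ℂ h a‖ * ‖(fderiv ℂ h a).inverse‖ := by
    rw [← ContinuousLinearMap.norm_id (𝕜 := ℂ) (E := Cn n), ← h3]
    exact ContinuousLinearMap.opNorm_comp_le _ _
  have h5 := h4.trans (mul_le_mul_of_nonneg_left h1 (norm_nonneg _))
  have hr0 := hr.1
  rw [← mul_div_assoc, le_div_iff₀ hr0, one_mul] at h5
  exact h5

theorem IsPH.norm_addConj_section_sub_le (hf : IsPH B k h g) (hB : IsOpen B) (hk : 0 ≤ k)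
    {a : Cn n} (ha : a ∈ B) {r : ℝ} (hr : 0 < r) {Φ : Cn n → Cn n} (hΦ : IsSectionOn h B a r Φ)
    {w : Cn n} (hw : w ∈ Metric.ball (h a) r) :
    dist (addConj (g ∘ Φ) w) (pluri h g a) ≤ mu k (‖dilatation h g a‖ / k) * r := by
  have hd := hf.differentiableOn_comp_section hB hΦ
  have hle := hf.norm_fderiv_comp_section_le hB hΦ
  have hmem := Metric.mem_ball_self (x := h a) hr
  have hgrow : ‖(g ∘ Φ) w - (g ∘ Φ) (h a)‖ ≤ k * r * growth (‖dilatation h g a‖ / k) 1 := by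
    -- For `k = 0` the map `g ∘ Φ` is constant and the ratio `‖ω‖ / k` is irrelevant.
    rcases hk.eq_or_lt with rfl | hk
    · have := norm_sub_le_of_fderiv_le hd hle hw hmem
      simpa using this
    · have h0 := hf.dilatation_le a ha
      refine norm_sub_le_growth hk hd hle ?_ (by positivity) ((div_le_one hk).2 h0) hw
      rw [(hf.hasFDerivAt_comp_section hB hΦ hmem).fderiv, hΦ.map_center,
        mul_div_cancel₀ _ hk.ne']
  have heq : addConj (g ∘ Φ) w - pluri h g a
      = (w - h a) + conjVec ((g ∘ Φ) w - (g ∘ Φ) (h a)) := by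
    rw [← addConj_section_center hΦ, conjVec_sub]
    simp only [addConj]
    abel
  have hwr : ‖w - h a‖ ≤ r := by
    rw [← dist_eq_norm]; exact (Metric.mem_ball.1 hw).le
  rw [dist_eq_norm, heq, mu_eq_growth]
  refine (norm_add_le _ _).trans ?_
  rw [norm_conjVec]
  linarith

theorem IsPH.univalentRadii_le (hf : IsPH B k h g) (hB : IsOpen B) (hbd : Bornology.IsBounded B)
    (hn : 1 ≤ n) (hk : 0 ≤ k) (hk1 : k < 1) {a : Cn n} (ha : a ∈ B) {ρ : ℝ}
    (hρ : ρ ∈ univalentRadii B (pluri h g) a) :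
    ρ ≤ mu k (‖dilatation h g a‖ / k) * blochRadius B h a := by
  by_contra! hlt
  have hF := hf.locally_biholomorphic.isLocalHomeoOn hB
  have hG := hf.isLocalHomeoOn hB hk hk1
  have hbdd := hf.locally_biholomorphic.bddAbove_univalentRadii hB hbd hn a
  have hmax := (hF.isGreatest_blochRadius ha hbdd).1
  set R := blochRadius B h a
  have hR : 0 < R := hmax.1
  obtain ⟨Φ, hΦ⟩ := hF.exists_isSectionOn hmax
  obtain ⟨G, hGs⟩ := hG.exists_isSectionOn hρ
  have hd := hf.differentiableOn_comp_section hB hΦ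
  have hle := hf.norm_fderiv_comp_section_le hB hΦ
  have hlip : LipschitzOnWith (NNReal.mk (1 + k) (by positivity)) (addConj (g ∘ Φ)) (Metric.ball (h a) R) := by
    refine LipschitzOnWith.of_dist_le_mul fun v hv w hw => ?_
    rw [dist_eq_norm, dist_eq_norm, NNReal.coe_mk]
    have heq : addConj (g ∘ Φ) v - addConj (g ∘ Φ) w
        = (v - w) + conjVec ((g ∘ Φ) v - (g ∘ Φ) w) := by
      rw [conjVec_sub]
      simp only [addConj]
      abel
    rw [heq]
    refine (norm_add_le _ _).trans ?_
    rw [norm_conjVec]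
    linarith [norm_sub_le_of_fderiv_le hd hle hv hw]
  have hclos : closure (Metric.ball (h a) R) = Metric.closedBall (h a) R :=
    closure_ball _ hR.ne'
  obtain ⟨T, hTc, hTeq⟩ : ∃ T : Cn n → Cn n, ContinuousOn T (Metric.closedBall (h a) R) ∧
      EqOn (addConj (g ∘ Φ)) T (Metric.ball (h a) R) := by
    -- The extension may have a worse Lipschitz constant; only its continuity up to the sphere is
    -- used.
    obtain ⟨T, hT, hTeq⟩ := hlip.extend_finite_dimension
    exact ⟨T, hT.continuous.continuousOn, hTeq⟩
  have hTmaps : MapsTo T (Metric.closedBall (h a) R) (Metric.ball (pluri h g a) ρ) := by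
    have hcl : MapsTo T (closure (Metric.ball (h a) R))
        (closure (Metric.closedBall (pluri h g a) (mu k (‖dilatation h g a‖ / k) * R))) := by
      refine MapsTo.closure_of_continuousOn ?_ (by rwa [hclos])
      intro w hw
      rw [← hTeq hw]
      exact hf.norm_addConj_section_sub_le hB hk ha hR hΦ hw
    rw [hclos, Metric.isClosed_closedBall.closure_eq] at hcl
    exact hcl.mono_right (Metric.closedBall_subset_ball hlt)
  have hcen := Metric.mem_ball_self (x := h a) hR
  have hTa : T (h a) = pluri h g a := by rw [← hTeq hcen, addConj_section_center hΦ]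
  have hcont : ContinuousOn (G ∘ T) (Metric.closedBall (h a) R) := hGs.continuousOn.comp hTc hTmaps
  have hmaps : MapsTo (G ∘ T) (Metric.closedBall (h a) R) B := hGs.mapsTo.comp hTmaps
  have hball : Metric.ball (h a) R ⊆ Metric.closedBall (h a) R := Metric.ball_subset_closedBall
  -- Both are lifts of `addConj (g ∘ Φ)` through `pluri h g` that agree at the centre.
  have hGT : EqOn (G ∘ T) Φ (Metric.ball (h a) R) := by
    refine hG.eqOn_lift (convex_ball _ _).isPreconnected (hcont.mono hball) hΦ.continuousOn
      (hmaps.mono_left hball) hΦ.mapsTo (fun w hw => ?_) hcen ?_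
    · rw [Function.comp_apply, hGs.rightInv _ (hTmaps (hball hw)), pluri_section hΦ hw, hTeq hw]
    · rw [Function.comp_apply, hTa, hGs.map_center, hΦ.map_center]
  have hright : ∀ w ∈ Metric.closedBall (h a) R, h ((G ∘ T) w) = w := by
    have : EqOn (h ∘ (G ∘ T)) id (Metric.closedBall (h a) R) := by
      refine EqOn.of_subset_closure (s := Metric.ball (h a) R) (fun w hw => ?_)
        (hF.continuousOn.comp hcont hmaps) continuousOn_id hball hclos.ge
      rw [Function.comp_apply, hGT hw, hΦ.rightInv w hw, id]
    exact this
  obtain ⟨s, hs, hRs⟩ := hF.exists_gt_mem_univalentRadii hR hcont hmaps hright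
    (by rw [hGT hcen, hΦ.map_center])
  exact absurd (le_csSup hbdd hs) hRs.not_ge

end PH

/-! ### The unit ball of a norm is open and bounded -/

section UnitBall

variable (p : Seminorm ℂ (Cn n))

theorem continuous_seminorm : Continuous p :=
  continuousOn_univ.1 (p.convexOn.continuousOn isOpen_univ)

theorem isOpen_ball_seminorm : IsOpen (p.ball 0 1) := by
  have : p.ball 0 1 = p ⁻¹' Iio 1 := by
    ext x; simp [Seminorm.mem_ball]
  rw [this]
  exact isOpen_Iio.preimage (continuous_seminorm p)

variable {p}

theorem isBounded_ball_seminorm (hp : ∀ x, p x = 0 → x = 0) :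
    Bornology.IsBounded (p.ball 0 1) := by
  -- The empty sphere is the zero-dimensional case; otherwise `p` has a positive minimum on the
  -- sphere.
  rcases (Metric.sphere (0 : Cn n) 1).eq_empty_or_nonempty with he | hne
  · refine Metric.isBounded_closedBall.subset (t := Metric.closedBall 0 0) fun x _ => ?_
    by_contra hx
    have hx0 : x ≠ 0 := by simpa using hx
    have : ((‖x‖⁻¹ : ℝ) : ℂ) • x ∈ Metric.sphere (0 : Cn n) 1 := by
      rw [mem_sphere_zero_iff_norm, norm_smul, Complex.norm_real, norm_inv, norm_norm,
        inv_mul_cancel₀ (norm_ne_zero_iff.2 hx0)]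
    rw [he] at this
    exact this
  obtain ⟨e, he, hmin⟩ := (isCompact_sphere (0 : Cn n) 1).exists_isMinOn hne
    (continuous_seminorm p).continuousOn
  have hpe : 0 < p e := by
    refine lt_of_le_of_ne (apply_nonneg p e) fun h => ?_
    rw [mem_sphere_zero_iff_norm, hp e h.symm, norm_zero] at he
    exact zero_ne_one he
  refine Metric.isBounded_closedBall.subset (t := Metric.closedBall 0 (1 / p e)) fun x hx => ?_
  rw [Seminorm.mem_ball_zero] at hx
  rw [mem_closedBall_zero_iff, le_div_iff₀ hpe]
  rcases eq_or_ne x 0 with rfl | hx0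
  · simp
  have hn0 := norm_pos_iff.2 hx0
  have hs : ((‖x‖⁻¹ : ℝ) : ℂ) • x ∈ Metric.sphere (0 : Cn n) 1 := by
    rw [mem_sphere_zero_iff_norm, norm_smul, Complex.norm_real, norm_inv, norm_norm,
      inv_mul_cancel₀ hn0.ne']
  have h := hmin hs
  simp only [mem_ofPred_eq, map_smul_eq_mul, Complex.norm_real, norm_inv, norm_norm] at h
  rw [inv_mul_eq_div, le_div_iff₀ hn0] at h
  linarith

end UnitBall

/-! ### Linear examples and sharpness of the lower bound -/

section Linear

variable {B : Set (Cn n)} {k : ℝ}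

theorem dilatation_id (A : Cn n →L[ℂ] Cn n) (z : Cn n) : dilatation id A z = A := by
  simp [dilatation]

theorem isPH_id (hB : IsOpen B) (A : Cn n →L[ℂ] Cn n) (hA : ‖A‖ ≤ k) : IsPH B k id A where
  locally_biholomorphic z hz := ⟨B, B, hz, subset_rfl, hB, hB, differentiableOn_id, bijOn_id B,
    id, differentiableOn_id, fun _ _ => rfl⟩
  holomorphic := A.differentiable.differentiableOn
  h_zero := rfl
  g_zero := map_zero A
  dilatation_le z _ := by rwa [dilatation_id]

theorem exists_isPH_norm_dilatation_eq (hB : IsOpen B) (hn : 1 ≤ n) (hk : 0 < k) (z : Cn n) {x : ℝ}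
    (hx : x ∈ Icc (0 : ℝ) 1) :
    ∃ h g : Cn n → Cn n, IsPH B k h g ∧ ‖dilatation h g z‖ / k = x := by
  have : Nonempty (Fin n) := ⟨⟨0, hn⟩⟩
  have hA : ‖((k * x : ℝ) : ℂ) • ContinuousLinearMap.id ℂ (Cn n)‖ = k * x := by
    rw [norm_smul, ContinuousLinearMap.norm_id, mul_one, Complex.norm_real,
      Real.norm_of_nonneg (mul_nonneg hk.le hx.1)]
  refine ⟨id, ⇑(((k * x : ℝ) : ℂ) • ContinuousLinearMap.id ℂ (Cn n)), isPH_id hB _ ?_, ?_⟩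
  · rw [hA]
    exact mul_le_of_le_one_right hk.le hx.2
  · rw [dilatation_id, hA, mul_div_cancel_left₀ _ hk.ne']

/-- On a bounded open set, the identity plus the conjugate of a suitable linear map of rank one
attains the lower bound at a given point. -/
theorem exists_isPH_blochRadius_div_eq (hB : IsOpen B) (hbd : Bornology.IsBounded B) (hn : 1 ≤ n)
    (hk : 0 ≤ k) (hk1 : k < 1) {a : Cn n} (ha : a ∈ B) :
    ∃ h g : Cn n → Cn n, IsPH B k h g ∧
      blochRadius B (pluri h g) a / blochRadius B h a = 1 - k := by
  have : Nonempty (Fin n) := ⟨⟨0, hn⟩⟩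
  have hne : Bᶜ.Nonempty := by
    rw [nonempty_compl]
    rintro rfl
    exact NormedSpace.unbounded_univ ℂ (Cn n) hbd
  obtain ⟨b, hb, hab⟩ := hB.isClosed_compl.exists_infDist_eq_dist hne a
  set e := b - a with he
  have he0 : e ≠ 0 := by
    rw [he, sub_ne_zero]
    rintro rfl
    exact hb ha
  have hR : 0 < ‖e‖ := norm_pos_iff.2 he0
  have hRd : dist a b = ‖e‖ := by rw [dist_comm, dist_eq_norm]
  -- Chosen so that `conjVec (A e) = -k • e` and `‖A‖ = k`: the nearest point `b` outside `B` is
  -- pulled towards the centre by the factor `1 - k`.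
  set A : Cn n →L[ℂ] Cn n :=
    (innerSL ℂ e).smulRight (-((k / ‖e‖ ^ 2 : ℝ) : ℂ) • conjVec e) with hA
  have hAn : ‖A‖ ≤ k := by
    rw [hA, ContinuousLinearMap.norm_smulRight_apply, innerSL_apply_norm, norm_smul, norm_conjVec,
      norm_neg, Complex.norm_real, Real.norm_of_nonneg (by positivity)]
    apply le_of_eq
    field_simp
  have hAe : conjVec (A e) = -(k : ℂ) • e := by
    have h1 : A e = -(k : ℂ) • conjVec e := by
      rw [hA, ContinuousLinearMap.smulRight_apply, innerSL_apply_apply, inner_self_eq_norm_sq_to_K,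
        smul_smul]
      congr 1
      have : (‖e‖ : ℂ) ≠ 0 := by exact_mod_cast hR.ne'
      push_cast
      simp only [Complex.coe_algebraMap]
      field_simp
    rw [h1, conjVec_smul, conjVec_conjVec]
    simp
  have hf := isPH_id hB A hAn
  have hrid : ‖e‖ ∈ univalentRadii B id a := by
    refine ⟨hR, Metric.ball a ‖e‖, Metric.isOpen_ball, ?_, Metric.mem_ball_self hR, bijOn_id _⟩
    rw [← hRd, ← hab]
    exact Metric.ball_infDist_compl_subset
  have hid : IsGreatest (univalentRadii B id a) ‖e‖ := by
    refine ⟨hrid, ?_⟩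
    rintro r ⟨hr, V, -, hVB, -, hbij⟩
    by_contra! hlt
    obtain ⟨v, hv, hvb⟩ := hbij.surjOn (show b ∈ Metric.ball (id a) r by
      rw [Metric.mem_ball, id, dist_comm, hRd]; exact hlt)
    rw [id] at hvb
    exact hb (hVB (hvb ▸ hv))
  have hpl : IsGreatest (univalentRadii B (pluri id A) a) ((1 - k) * ‖e‖) := by
    refine ⟨hf.mul_mem_univalentRadii hB hk hk1 hrid, ?_⟩
    rintro r ⟨hr, V, -, hVB, -, hbij⟩
    by_contra! hlt
    have hsub : ∀ v w : Cn n, pluri id A v - pluri id A w = (v - w) + conjVec (A (v - w)) := by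
      intro v w
      simp only [pluri, id, map_sub, conjVec_sub]
      abel
    obtain ⟨v, hv, hvb⟩ := hbij.surjOn (show pluri id A b ∈ Metric.ball (pluri id A a) r by
      rw [mem_ball_iff_norm, hsub, ← he, hAe]
      have : e + -(k : ℂ) • e = ((1 - k : ℝ) : ℂ) • e := by
        push_cast
        module
      rw [this, norm_smul, Complex.norm_real, Real.norm_of_nonneg (by linarith)]
      exact hlt)
    -- The map is injective on the whole space because `k < 1`, so the value at `b ∉ B` is not taken
    -- in `B`.
    have hvb0 : v - b = 0 := by
      by_contra hne
      have h0 := hsub v b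
      rw [hvb, sub_self] at h0
      have h1 : ‖v - b‖ ≤ k * ‖v - b‖ := by
        calc ‖v - b‖ = ‖A (v - b)‖ := by
              rw [eq_neg_of_add_eq_zero_left h0.symm, norm_neg, norm_conjVec,
                ← eq_neg_of_add_eq_zero_left h0.symm]
          _ ≤ k * ‖v - b‖ := A.le_of_opNorm_le hAn _
      nlinarith [norm_pos_iff.2 hne]
    exact hb (hVB (sub_eq_zero.1 hvb0 ▸ hv))
  refine ⟨id, A, hf, ?_⟩
  rw [blochRadius, blochRadius, hid.csSup_eq, hpl.csSup_eq, mul_div_cancel_right₀ _ hR.ne']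

end Linear

/-! ### Assembly of the estimates -/

theorem IsPH.ratio_bounds {B : Set (Cn n)} {k : ℝ} {h g : Cn n → Cn n} (hf : IsPH B k h g)
    (hB : IsOpen B) (hbd : Bornology.IsBounded B) (hn : 1 ≤ n) (hk : 0 ≤ k) (hk1 : k < 1)
    {z : Cn n} (hz : z ∈ B) :
    IsGreatest (univalentRadii B (pluri h g) z) (blochRadius B (pluri h g) z) ∧
      IsGreatest (univalentRadii B h z) (blochRadius B h z) ∧
      1 - k ≤ blochRadius B (pluri h g) z / blochRadius B h z ∧
      blochRadius B (pluri h g) z / blochRadius B h z ≤ mu k (‖dilatation h g z‖ / k) ∧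
      mu k (‖dilatation h g z‖ / k) ≤ mu k 1 := by
  have hmax := (hf.locally_biholomorphic.isLocalHomeoOn hB).isGreatest_blochRadius hz
    (hf.locally_biholomorphic.bddAbove_univalentRadii hB hbd hn z)
  have hle := fun ρ hρ => hf.univalentRadii_le hB hbd hn hk hk1 hz (ρ := ρ) hρ
  have hmaxf := (hf.isLocalHomeoOn hB hk hk1).isGreatest_blochRadius hz ⟨_, hle⟩
  have hR := hmax.1.1
  refine ⟨hmaxf, hmax, ?_, ?_, ?_⟩
  · rw [le_div_iff₀ hR]
    exact hmaxf.2 (hf.mul_mem_univalentRadii hB hk hk1 hmax.1)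
  · rw [div_le_iff₀ hR]
    exact hle _ hmaxf.1
  · exact mu_le_mu_one hk (by positivity) (div_le_one_of_le₀ (hf.dilatation_le z hz) hk)

end PluriBloch

theorem mainTheorem3 (n : ℕ) (hn : 1 ≤ n)
    (p : Seminorm ℂ (PluriBloch.Cn n)) (hp : ∀ x, p x = 0 → x = 0)
    (hB : PluriBloch.IsHomogeneous (p.ball 0 1)) :
    -- the largest univalent balls exist, and the two-sided estimate of the ratio
    (∀ k : ℝ, 0 ≤ k → k < 1 → ∀ h g : PluriBloch.Cn n → PluriBloch.Cn n,
      PluriBloch.IsPH (p.ball 0 1) k h g → ∀ z ∈ p.ball 0 1,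
        IsGreatest (PluriBloch.univalentRadii (p.ball 0 1) (PluriBloch.pluri h g) z)
          (PluriBloch.blochRadius (p.ball 0 1) (PluriBloch.pluri h g) z) ∧
        IsGreatest (PluriBloch.univalentRadii (p.ball 0 1) h z)
          (PluriBloch.blochRadius (p.ball 0 1) h z) ∧
        1 - k ≤ PluriBloch.blochRadius (p.ball 0 1) (PluriBloch.pluri h g) z /
          PluriBloch.blochRadius (p.ball 0 1) h z ∧
        PluriBloch.blochRadius (p.ball 0 1) (PluriBloch.pluri h g) z /
          PluriBloch.blochRadius (p.ball 0 1) h z ≤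
            PluriBloch.mu k (‖PluriBloch.dilatation h g z‖ / k) ∧
        PluriBloch.mu k (‖PluriBloch.dilatation h g z‖ / k) ≤ PluriBloch.mu k 1) ∧
    -- the values of `μ_k` at `1` and at `0`
    (∀ k : ℝ, 0 ≤ k → k < 1 → PluriBloch.mu k 1 = 1 + k ∧
      PluriBloch.mu k 0 = 1 + k / 2 ∧
      Tendsto (PluriBloch.mu k) (𝓝[>] 0) (𝓝 (PluriBloch.mu k 0))) ∧
    -- the lower bound is sharp at every point
    (∀ k : ℝ, 0 ≤ k → k < 1 → ∀ z ∈ p.ball 0 1,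
      ∃ h g : PluriBloch.Cn n → PluriBloch.Cn n, PluriBloch.IsPH (p.ball 0 1) k h g ∧
        PluriBloch.blochRadius (p.ball 0 1) (PluriBloch.pluri h g) z /
          PluriBloch.blochRadius (p.ball 0 1) h z = 1 - k) ∧
    -- the upper bound is asymptotically sharp as `k` tends to `0`
    (∀ x ∈ Icc (0 : ℝ) 1, Tendsto (fun k => PluriBloch.mu k x) (𝓝[>] 0) (𝓝 1)) ∧
    (∀ ε : ℝ, 0 < ε → ∃ δ : ℝ, 0 < δ ∧ δ ≤ 1 ∧ ∀ k : ℝ, 0 < k → k < δ →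
      ∀ h g : PluriBloch.Cn n → PluriBloch.Cn n,
        PluriBloch.IsPH (p.ball 0 1) k h g → ∀ z ∈ p.ball 0 1,
          (1 - ε) * PluriBloch.mu k (‖PluriBloch.dilatation h g z‖ / k) <
            PluriBloch.blochRadius (p.ball 0 1) (PluriBloch.pluri h g) z /
              PluriBloch.blochRadius (p.ball 0 1) h z ∧
          (1 - ε) * (1 + k) <
            PluriBloch.blochRadius (p.ball 0 1) (PluriBloch.pluri h g) z /
              PluriBloch.blochRadius (p.ball 0 1) h z) ∧
    (∀ k : ℝ, 0 < k → k < 1 → ∀ z ∈ p.ball 0 1, ∀ x ∈ Icc (0 : ℝ) 1,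
      ∃ h g : PluriBloch.Cn n → PluriBloch.Cn n, PluriBloch.IsPH (p.ball 0 1) k h g ∧
        ‖PluriBloch.dilatation h g z‖ / k = x) := by
  have hO := PluriBloch.isOpen_ball_seminorm p
  have hbd := PluriBloch.isBounded_ball_seminorm hp
  refine ⟨fun k hk hk1 h g hf z hz => hf.ratio_bounds hO hbd hn hk hk1 hz,
    fun k _ _ => ⟨PluriBloch.mu_one k, PluriBloch.mu_zero k, PluriBloch.tendsto_mu_zero k⟩,
    fun k hk hk1 z hz => PluriBloch.exists_isPH_blochRadius_div_eq hO hbd hn hk hk1 hz,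
    fun x _ => PluriBloch.tendsto_mu_of_param_zero x, fun ε hε => ?_,
    fun k hk _ z _ x hx => PluriBloch.exists_isPH_norm_dilatation_eq hO hn hk z hx⟩
  -- The lower bound suffices: for `ε ≤ 1`, `2 * k < ε` gives `(1 - ε) * (1 + k) < 1 - k`; for `ε ≥
  -- 1` the left sides are nonpositive.
  refine ⟨min 1 (ε / 2), by positivity, min_le_left _ _, fun k hk hkδ h g hf z hz => ?_⟩
  have hk1 : k < 1 := hkδ.trans_le (min_le_left _ _)
  have hkε : k < ε / 2 := hkδ.trans_le (min_le_right _ _)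
  obtain ⟨-, -, hlow, hup, hmu⟩ := hf.ratio_bounds hO hbd hn hk.le hk1 hz
  rw [PluriBloch.mu_one] at hmu
  have hmu0 := hlow.trans hup
  rcases le_total 1 ε with h1 | h1 <;> constructor <;> nlinarith
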